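/- **Lemma (Mean and variance of a homogeneous NRM).** Let $(\mathbb{X},\mathcal{B}(\mathbb{X}))$ be a measurable space, $P$ a probability measure on it, $M>0$, and $\rho_\eta$ a measure on $\mathbb{R}^+=(0,\infty)$ with $\rho_\eta(\mathbb{R}^+)=\infty$ and $\int_0^\infty \min(t,1)\,\rho_\eta(\mathrm{d}t)<\infty$ (the latter holds in particular if $\int_0^\infty t\,\rho_\eta(\mathrm{d}t)<\infty$). Let $N$ be a Poisson random measure on $\mathbb{R}^+\times\mathbb{X}$ with mean measure $\nu(\mathrm{d}t,\mathrm{d}x)=M\rho_\eta(\mathrm{d}t)P(\mathrm{d}x)$: for every measurable $A$, $N(A)$ is Poisson distributed with mean $\nu(A)$ (and $N(A)=\infty$ almost surely if $\nu(A)=\infty$), and $N(A_1),\dots,N(A_n)$ are independent for disjoint measurable $A_1,\dots,A_n$. Let $$\tilde\mu(B)=\int_{\mathbb{R}^+\times B} t\,N(\mathrm{d}t,\mathrm{d}x),\qquad \mu(B)=\frac{\tilde\mu(B)}{\tilde\mu(\mathbb{X})},\qquad B\in\mathcal{B}(\mathbb{X}),$$ be the associated completely random measure and normalized random measure (NRM)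 with Lévy measure $\nu$ (where $\tilde\mu(\mathbb{X})\in\{0,\infty\}$, an event of probability zero, $\mu$ may be given any conventional value). Let $$\psi_\eta(v)=\int_{\mathbb{R}^+\times\mathbb{X}}\bigl(1-e^{-tv}\bigr)\,\nu(\mathrm{d}t,\mathrm{d}x),\qquad \tilde\psi_\eta(v)=\frac1M\psi_\eta(v)$$ be the Laplace exponent and the Laplace exponent with the mass removed. Then for every $B\in\mathcal{B}(\mathbb{X})$ the random variable $\mu(B)$ is square integrable, with mean $$\mathbb{E}[\mu(B)]=P(B);$$ moreover $\tilde\psi_\eta$ is twice differentiable on $(0,\infty)$, the function $v\mapsto v\,\tilde\psi_\eta''(v)\,e^{-M\tilde\psi_\eta(v)}$ is integrable on $(0,\infty)$, and $$\operatorname{Var}(\mu(B))=P(B)\,\bigl(P(B)-1\bigr)\,M\int_0^\infty v\,\tilde\psi_\eta''(v)\,e^{-M\tilde\psi_\eta(v)}\,\mathrm{d}v .$$ -/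

import Mathlib

open MeasureTheory ProbabilityTheory Set
open scoped ENNReal NNReal

noncomputable section

/-- The half line of jump sizes, the open interval from `0` to infinity. -/
abbrev JumpSize : Type := Set.Ioi (0 : ℝ)

/-- The Poisson distribution with mean `c ∈ [0, ∞]` on `{0, 1, 2, …, ∞}` (as a subset of `ℝ≥0∞`);
for `c = ∞` it is, as usual, concentrated at `∞`. -/
def poissonLaw (c : ℝ≥0∞) : Measure ℝ≥0∞ :=
  if c = ∞ then Measure.dirac ∞
  else (poissonMeasure c.toNNReal).map (fun n : ℕ => (n : ℝ≥0∞))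

/-- `N` is a Poisson random measure on `S` with mean measure `ν`, defined on the probability space
`(Ω, Pr)`: `N` is a random measure, `N(A)` is Poisson with mean `ν(A)` for every measurable `A`, and
`N(A₁), …, N(Aₙ)` are independent for disjoint measurable `A₁, …, Aₙ`. -/
structure IsPoissonRandomMeasure {Ω S : Type*} [MeasurableSpace Ω] [MeasurableSpace S]
    (N : Ω → Measure S) (ν : Measure S) (Pr : Measure Ω) : Prop where
  measurable : Measurable N
  hasLaw : ∀ A : Set S, MeasurableSet A → HasLaw (fun ω => N ω A) (poissonLaw (ν A)) Pr
  indep : ∀ (n : ℕ) (A : Fin n → Set S), (∀ i, MeasurableSet (A i)) →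
    Pairwise (Function.onFun Disjoint A) → iIndepFun (fun i ω => N ω (A i)) Pr

/-- The measure `B ↦ ∫_{ℝ⁺ × B} t m(dt, dx)` obtained from a measure `m` on `ℝ⁺ × 𝕏`
(see `jumpMeasure_apply`). -/
def jumpMeasure {X : Type*} [MeasurableSpace X] (m : Measure (JumpSize × X)) : Measure X :=
  (m.withDensity fun p => ENNReal.ofReal (p.1 : ℝ)).map Prod.snd

theorem jumpMeasure_apply {X : Type*} [MeasurableSpace X] (m : Measure (JumpSize × X))
    {B : Set X} (hB : MeasurableSet B) :
    jumpMeasure m B = ∫⁻ p in univ ×ˢ B, ENNReal.ofReal (p.1 : ℝ) ∂m := by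
  rw [jumpMeasure, Measure.map_apply measurable_snd hB,
    withDensity_apply _ (measurable_snd hB), univ_prod]

/-- The completely random measure driven by the Poisson random measure `N` on `ℝ⁺ × 𝕏`. -/
def crm {Ω X : Type*} [MeasurableSpace X] (N : Ω → Measure (JumpSize × X)) (ω : Ω) : Measure X :=
  jumpMeasure (N ω)

/-- The normalized random measure: the completely random measure divided by its total mass. -/
def nrm {Ω X : Type*} [MeasurableSpace X] (N : Ω → Measure (JumpSize × X)) (ω : Ω) : Measure X :=
  (crm N ω univ)⁻¹ • crm N ω

/-- The homogeneous Lévy measure `M ρ(dt) P(dx)`. -/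
def homogeneousLevy {X : Type*} [MeasurableSpace X] (M : ℝ) (ρ : Measure JumpSize)
    (P : Measure X) : Measure (JumpSize × X) :=
  ENNReal.ofReal M • ρ.prod P

/-- The Laplace exponent `ψ(v) = ∫ (1 - exp(-t v)) ν(dt, dx)` of a Lévy measure `ν`. -/
def laplaceExponent {X : Type*} [MeasurableSpace X] (ν : Measure (JumpSize × X)) (v : ℝ) : ℝ :=
  ∫ p, (1 - Real.exp (-((p.1 : ℝ) * v))) ∂ν

/-- The Laplace exponent with the mass removed, `ψ̃ = ψ / M`, in the homogeneous case. -/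
def reducedLaplaceExponent {X : Type*} [MeasurableSpace X] (M : ℝ) (ρ : Measure JumpSize)
    (P : Measure X) (v : ℝ) : ℝ :=
  (1 / M) * laplaceExponent (homogeneousLevy M ρ P) v

end

/-!
# Mean and variance of a homogeneous normalized random measure

Write `T` for the total random mass, `X` and `Y` for the random masses of `B` and of its complement,
`p = P(B)`, and `φ = M ψ̃` for the Laplace exponent of `T`.

The Laplace functional of a Poisson random measure, `E exp (-∫ f dN) = exp (-∫ (1 - exp (-f)) dν)`
(`IsPoissonRandomMeasure.lintegral_expNeg_lintegral`), follows for simple functions from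
independence on disjoint sets and the Laplace transform of the Poisson distribution, and in general
by monotone approximation. It gives the joint Laplace transform
`E exp (-(a X + b Y)) = exp (-(p φ(a) + (1 - p) φ(b)))` (`integral_exp_crm`). Letting `v → 0` in
`E exp (-v T)` shows that `T` is almost surely finite; it is almost surely positive because there
are almost surely infinitely many jumps.

The cumulant generating function of `X` under the measure with density `exp (-v T)` is
`s ↦ -(p φ(v - s) + (1 - p) φ(v))` near `0`, so its first two derivatives at `0` give
* `E [X exp (-v T)] = p φ'(v) exp (-φ(v))`,
* `E [X² exp (-v T)] = (p² φ'(v)² - p φ''(v)) exp (-φ(v))`.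

Since `1 / T = ∫₀^∞ exp (-v T) dv` and `1 / T² = ∫₀^∞ v exp (-v T) dv`, integrating over `v` gives
the first two moments of `X / T`. No integral has to be computed: the case `B = univ`, where
`X / T = 1`, shows that `∫ φ' exp (-φ) = 1` and `∫ v (φ'² - φ'') exp (-φ) dv = 1`. The mean is
therefore `p` and the second moment is `p² + (p² - p) ∫ v φ'' exp (-φ) dv`.

Smoothness needs no differentiation under the integral over the infinite measure `ρ`: on the open
half line `φ(v)` is minus the cumulant generating function of `T` at `-v`, hence analytic, and
`φ'' ≤ 0` because `-φ''` is a variance. This sign gives the integrability of `v φ'' exp (-φ)`.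
-/

/-! ### The function `exp (-x)` on `[0, ∞]` -/

/-- The function `x ↦ exp (-x)` on `[0, ∞]`, with value `0` at `∞`. -/
noncomputable def expNeg (x : ℝ≥0∞) : ℝ≥0∞ := EReal.exp (-(x : EReal))

@[simp] lemma expNeg_zero : expNeg 0 = 1 := by simp [expNeg]

@[simp] lemma expNeg_top : expNeg ∞ = 0 := by simp [expNeg]

lemma expNeg_ofReal {x : ℝ} (hx : 0 ≤ x) :
    expNeg (ENNReal.ofReal x) = ENNReal.ofReal (Real.exp (-x)) := by
  rw [expNeg, EReal.coe_ennreal_ofReal, max_eq_left hx, ← EReal.coe_neg, EReal.exp_coe]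

lemma expNeg_of_ne_top {x : ℝ≥0∞} (hx : x ≠ ∞) :
    expNeg x = ENNReal.ofReal (Real.exp (-x.toReal)) := by
  conv_lhs => rw [← ENNReal.ofReal_toReal hx]
  exact expNeg_ofReal ENNReal.toReal_nonneg

lemma antitone_expNeg : Antitone expNeg := fun x y h => by
  apply EReal.exp_monotone
  simpa using h

lemma expNeg_le_one (x : ℝ≥0∞) : expNeg x ≤ 1 := by
  simpa using antitone_expNeg (zero_le (a := x))

lemma expNeg_ne_top (x : ℝ≥0∞) : expNeg x ≠ ∞ :=
  ((expNeg_le_one x).trans_lt ENNReal.one_lt_top).ne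

lemma continuous_expNeg : Continuous expNeg :=
  ENNReal.continuous_exp.comp (continuous_neg.comp continuous_coe_ennreal_ereal)

lemma measurable_expNeg : Measurable expNeg := continuous_expNeg.measurable

lemma expNeg_add (x y : ℝ≥0∞) : expNeg (x + y) = expNeg x * expNeg y := by
  rcases eq_or_ne x ∞ with rfl | hx
  · simp
  rcases eq_or_ne y ∞ with rfl | hy
  · simp
  rw [expNeg_of_ne_top hx, expNeg_of_ne_top hy, expNeg_of_ne_top (ENNReal.add_ne_top.2 ⟨hx, hy⟩),
    ENNReal.toReal_add hx hy, ← ENNReal.ofReal_mul (Real.exp_nonneg _), ← Real.exp_add, neg_add]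

lemma expNeg_sum {ι : Type*} (s : Finset ι) (f : ι → ℝ≥0∞) :
    expNeg (∑ i ∈ s, f i) = ∏ i ∈ s, expNeg (f i) := by
  induction s using Finset.cons_induction with
  | empty => simp
  | cons a s ha ih => rw [Finset.sum_cons, Finset.prod_cons, expNeg_add, ih]

lemma expNeg_mul_natCast (c : ℝ≥0∞) (n : ℕ) : expNeg (c * n) = expNeg c ^ n := by
  induction n with
  | zero => simp
  | succ n ih => rw [Nat.cast_succ, mul_add, mul_one, expNeg_add, ih, pow_succ]

lemma one_sub_expNeg_pos {c : ℝ≥0∞} (hc : c ≠ 0) : 1 - expNeg c ≠ 0 := by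
  rw [Ne, tsub_eq_zero_iff_le, not_le]
  rcases eq_or_ne c ∞ with rfl | hc'
  · simp
  · rw [expNeg_of_ne_top hc', ← ENNReal.ofReal_one]
    refine (ENNReal.ofReal_lt_ofReal_iff one_pos).2 ?_
    have := ENNReal.toReal_pos hc hc'
    simpa using this

/-! ### Laplace functional of a Poisson random measure -/

/-- The Laplace transform of the Poisson distribution. -/
lemma lintegral_expNeg_poissonLaw (c l : ℝ≥0∞) :
    ∫⁻ y, expNeg (c * y) ∂poissonLaw l = expNeg ((1 - expNeg c) * l) := by
  have hm : Measurable fun y : ℝ≥0∞ => expNeg (c * y) :=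
    measurable_expNeg.comp (measurable_const.mul measurable_id)
  rcases eq_or_ne l ∞ with rfl | hl
  · rw [poissonLaw, if_pos rfl, lintegral_dirac' _ hm]
    rcases eq_or_ne c 0 with rfl | hc
    · simp
    · rw [ENNReal.mul_top hc, ENNReal.mul_top (one_sub_expNeg_pos hc)]
  · lift l to ℝ≥0 using hl
    have hq : expNeg c ≠ ∞ := expNeg_ne_top c
    have hq1 : (expNeg c).toReal ≤ 1 := by
      simpa using ENNReal.toReal_mono ENNReal.one_ne_top (expNeg_le_one c)
    rw [poissonLaw, if_neg ENNReal.coe_ne_top, lintegral_map hm .of_discrete,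
      ENNReal.toNNReal_coe, poissonMeasure, lintegral_sum_measure]
    simp_rw [lintegral_smul_measure, lintegral_dirac, expNeg_mul_natCast, smul_eq_mul]
    set q : ℝ := (expNeg c).toReal with hqdef
    have hq0 : 0 ≤ q := ENNReal.toReal_nonneg
    have hqq : expNeg c = ENNReal.ofReal q := (ENNReal.ofReal_toReal hq).symm
    have hs : HasSum (fun n : ℕ => Real.exp (-l) * (l : ℝ) ^ n / (n.factorial : ℝ) * q ^ n)
        (Real.exp (-((1 - q) * l))) := by
      have h := (NormedSpace.expSeries_div_hasSum_exp (q * l : ℝ)).mul_left (Real.exp (-l))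
      rw [← Real.exp_eq_exp_ℝ, ← Real.exp_add] at h
      have he : -((1 - q) * (l : ℝ)) = -l + q * l := by ring
      rw [he]
      convert! h using 2 with n
      rw [mul_pow]; ring
    have h1 : (1 : ℝ≥0∞) - expNeg c = ENNReal.ofReal (1 - q) := by
      rw [hqq, ENNReal.ofReal_sub _ hq0, ENNReal.ofReal_one]
    rw [h1, ← ENNReal.ofReal_coe_nnreal, ← ENNReal.ofReal_mul (by linarith), expNeg_ofReal
      (mul_nonneg (by linarith) l.coe_nonneg), ← hs.tsum_eq,
      ENNReal.ofReal_tsum_of_nonneg (fun n => by positivity) hs.summable]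
    refine tsum_congr fun n => ?_
    rw [hqq, ← ENNReal.ofReal_pow hq0, ← ENNReal.ofReal_mul (by positivity)]

section Laplace

variable {Ω S : Type*} [MeasurableSpace Ω] [MeasurableSpace S]
  {N : Ω → Measure S} {ν : Measure S} {Pr : Measure Ω}

lemma IsPoissonRandomMeasure.lintegral_expNeg_mul (hN : IsPoissonRandomMeasure N ν Pr)
    (c : ℝ≥0∞) {A : Set S} (hA : MeasurableSet A) :
    ∫⁻ ω, expNeg (c * N ω A) ∂Pr = expNeg ((1 - expNeg c) * ν A) := by
  rw [← lintegral_expNeg_poissonLaw, (hN.hasLaw A hA).lintegral_comp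
    (f := fun y => expNeg (c * y))]
  exact (measurable_expNeg.comp (measurable_const.mul measurable_id)).aemeasurable

/-- The Laplace functional of a Poisson random measure at a simple function: the values of `N` on
the level sets of the function are independent Poisson variables. -/
lemma IsPoissonRandomMeasure.lintegral_expNeg_simpleFunc (hN : IsPoissonRandomMeasure N ν Pr)
    (f : SimpleFunc S ℝ≥0∞) :
    ∫⁻ ω, expNeg (∫⁻ s, f s ∂N ω) ∂Pr = expNeg (∫⁻ s, (1 - expNeg (f s)) ∂ν) := by
  have hr : ∫⁻ s, (1 - expNeg (f s)) ∂ν = ∑ x ∈ f.range, (1 - expNeg x) * ν (f ⁻¹' {x}) := by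
    have := SimpleFunc.map_lintegral (μ := ν) (fun x => 1 - expNeg x) f
    rw [← this, ← SimpleFunc.lintegral_eq_lintegral]
    rfl
  rw [hr]
  simp_rw [SimpleFunc.lintegral_eq_lintegral f, SimpleFunc.lintegral, expNeg_sum]
  set e := f.range.equivFin
  have hind : iIndepFun (fun (x : f.range) ω => N ω (f ⁻¹' {(x : ℝ≥0∞)})) Pr := by
    have h := hN.indep f.range.card (fun i => f ⁻¹' {((e.symm i : f.range) : ℝ≥0∞)})
      (fun i => f.measurableSet_preimage _) (fun i j hij => by
        refine Disjoint.preimage _ ?_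
        rw [disjoint_singleton]
        exact fun h => hij (e.symm.injective (Subtype.ext h)))
    have h' := h.precomp e.injective
    simpa [Function.comp_def] using h'
  have hme (x : ℝ≥0∞) : Measurable fun y : ℝ≥0∞ => expNeg (x * y) :=
    measurable_expNeg.comp (measurable_const.mul measurable_id)
  have hind' := hind.comp (fun x y => expNeg ((x : ℝ≥0∞) * y)) (fun x => hme x)
  have key := lintegral_prod_eq_prod_lintegral_of_indepFun Finset.univ _ hind' (fun x =>
    (hme x).comp (Measure.measurable_measure.1 hN.measurable _ (f.measurableSet_preimage _)))
  calc ∫⁻ ω, ∏ x ∈ f.range, expNeg (x * N ω (f ⁻¹' {x})) ∂Pr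
    _ = ∫⁻ ω, ∏ x : f.range, expNeg (x * N ω (f ⁻¹' {(x : ℝ≥0∞)})) ∂Pr :=
        lintegral_congr fun ω =>
          (Finset.prod_coe_sort f.range fun x => expNeg (x * N ω (f ⁻¹' {x}))).symm
    _ = ∏ x : f.range, ∫⁻ ω, expNeg (x * N ω (f ⁻¹' {(x : ℝ≥0∞)})) ∂Pr := key
    _ = ∏ x ∈ f.range, ∫⁻ ω, expNeg (x * N ω (f ⁻¹' {x})) ∂Pr :=
        Finset.prod_coe_sort f.range fun x => ∫⁻ ω, expNeg (x * N ω (f ⁻¹' {x})) ∂Pr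
    _ = ∏ x ∈ f.range, expNeg ((1 - expNeg x) * ν (f ⁻¹' {x})) :=
        Finset.prod_congr rfl fun x _ =>
          hN.lintegral_expNeg_mul x (f.measurableSet_preimage _)

/-- The Laplace functional of a Poisson random measure. -/
theorem IsPoissonRandomMeasure.lintegral_expNeg_lintegral [IsProbabilityMeasure Pr]
    (hN : IsPoissonRandomMeasure N ν Pr) {f : S → ℝ≥0∞} (hf : Measurable f) :
    ∫⁻ ω, expNeg (∫⁻ s, f s ∂N ω) ∂Pr = expNeg (∫⁻ s, (1 - expNeg (f s)) ∂ν) := by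
  have hlim (m : Measure S) : Filter.Tendsto
      (fun n => ∫⁻ s, SimpleFunc.eapprox f n s ∂m) Filter.atTop (nhds (∫⁻ s, f s ∂m)) :=
    lintegral_tendsto_of_tendsto_of_monotone
      (fun n => (SimpleFunc.measurable _).aemeasurable)
      (Filter.Eventually.of_forall fun s => fun i j hij => SimpleFunc.monotone_eapprox f hij s)
      (Filter.Eventually.of_forall fun s => SimpleFunc.tendsto_eapprox hf s)
  have hL : Filter.Tendsto (fun n => ∫⁻ ω, expNeg (∫⁻ s, SimpleFunc.eapprox f n s ∂N ω) ∂Pr)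
      Filter.atTop (nhds (∫⁻ ω, expNeg (∫⁻ s, f s ∂N ω) ∂Pr)) := by
    refine tendsto_lintegral_of_dominated_convergence (fun _ => 1) (fun n => ?_) (fun n => ?_) ?_ ?_
    · exact measurable_expNeg.comp
        ((Measure.measurable_lintegral (SimpleFunc.measurable _)).comp hN.measurable)
    · exact Filter.Eventually.of_forall fun ω => expNeg_le_one _
    · simp
    · exact Filter.Eventually.of_forall fun ω => (continuous_expNeg.tendsto _).comp (hlim (N ω))
  have hR : Filter.Tendsto (fun n => expNeg (∫⁻ s, (1 - expNeg (SimpleFunc.eapprox f n s)) ∂ν))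
      Filter.atTop (nhds (expNeg (∫⁻ s, (1 - expNeg (f s)) ∂ν))) := by
    refine (continuous_expNeg.tendsto _).comp ?_
    refine lintegral_tendsto_of_tendsto_of_monotone (fun n => ?_) ?_ ?_
    · exact (measurable_const.sub (measurable_expNeg.comp (SimpleFunc.measurable _))).aemeasurable
    · exact Filter.Eventually.of_forall fun s i j hij =>
        tsub_le_tsub_left (antitone_expNeg (SimpleFunc.monotone_eapprox f hij s)) _
    · refine Filter.Eventually.of_forall fun s => ?_
      exact ((ENNReal.continuous_sub_left ENNReal.one_ne_top).tendsto _).comp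
        ((continuous_expNeg.tendsto _).comp (SimpleFunc.tendsto_eapprox hf s))
  refine tendsto_nhds_unique hL ?_
  simpa only [hN.lintegral_expNeg_simpleFunc] using hR

end Laplace

/-! ### The Laplace exponent of the jump measure -/

/-- The Laplace exponent of the jump measure `ρ` with values in `[0, ∞]`. -/
noncomputable def jumpExponent (ρ : Measure JumpSize) (v : ℝ) : ℝ≥0∞ :=
  ∫⁻ t, (1 - expNeg (ENNReal.ofReal v * ENNReal.ofReal (t : ℝ))) ∂ρ

lemma measurable_ofReal_jumpSize : Measurable fun t : JumpSize => ENNReal.ofReal (t : ℝ) :=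
  ENNReal.measurable_ofReal.comp measurable_subtype_coe

lemma measurable_ofReal_fst {X : Type*} [MeasurableSpace X] :
    Measurable fun p : JumpSize × X => ENNReal.ofReal (p.1 : ℝ) :=
  measurable_ofReal_jumpSize.comp measurable_fst

lemma one_sub_expNeg_mul {v t : ℝ} (hv : 0 ≤ v) (ht : 0 ≤ t) :
    1 - expNeg (ENNReal.ofReal v * ENNReal.ofReal t) =
      ENNReal.ofReal (1 - Real.exp (-(t * v))) := by
  rw [← ENNReal.ofReal_mul hv, expNeg_ofReal (mul_nonneg hv ht), mul_comm v t,
    ENNReal.ofReal_sub _ (Real.exp_nonneg _), ENNReal.ofReal_one]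

lemma one_sub_exp_neg_le {t : ℝ} (ht : 0 ≤ t) (v : ℝ) :
    1 - Real.exp (-(t * v)) ≤ max v 1 * min t 1 := by
  have h1 : 1 - Real.exp (-(t * v)) ≤ t * v := by linarith [Real.add_one_le_exp (-(t * v))]
  have h2 : 1 - Real.exp (-(t * v)) ≤ 1 := by linarith [Real.exp_pos (-(t * v))]
  rcases le_total t 1 with h | h
  · rw [min_eq_left h]
    nlinarith [le_max_left v 1]
  · rw [min_eq_right h]
    linarith [le_max_right v 1]

lemma one_sub_expNeg_mul_le {v : ℝ} (hv : 0 ≤ v) (t : JumpSize) :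
    1 - expNeg (ENNReal.ofReal v * ENNReal.ofReal (t : ℝ)) ≤
      ENNReal.ofReal (max v 1) * min (ENNReal.ofReal (t : ℝ)) 1 := by
  have ht : 0 ≤ (t : ℝ) := le_of_lt t.2
  rw [one_sub_expNeg_mul hv ht, ← ENNReal.ofReal_one,
    ← ENNReal.ofReal_min, ← ENNReal.ofReal_mul (by positivity)]
  exact ENNReal.ofReal_le_ofReal (one_sub_exp_neg_le ht v)

section

variable {ρ : Measure JumpSize}

lemma jumpExponent_lt_top
    (hρ : ∫⁻ t, min (ENNReal.ofReal (t : ℝ)) 1 ∂ρ < ∞) {v : ℝ} (hv : 0 ≤ v) :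
    jumpExponent ρ v < ∞ := by
  refine (lintegral_mono fun t => one_sub_expNeg_mul_le hv t).trans_lt ?_
  rw [lintegral_const_mul _ (measurable_ofReal_jumpSize.min measurable_const)]
  exact ENNReal.mul_lt_top ENNReal.ofReal_lt_top hρ

lemma tendsto_jumpExponent_zero
    (hρ : ∫⁻ t, min (ENNReal.ofReal (t : ℝ)) 1 ∂ρ < ∞) :
    Filter.Tendsto (fun n : ℕ => jumpExponent ρ (1 / ((n : ℝ) + 1))) Filter.atTop (nhds 0) := by
  rw [← lintegral_zero (α := JumpSize) (μ := ρ)]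
  refine tendsto_lintegral_of_dominated_convergence
    (fun t => min (ENNReal.ofReal (t : ℝ)) 1) (fun n => ?_) (fun n => ?_) hρ.ne ?_
  · exact measurable_const.sub
      (measurable_expNeg.comp (measurable_const.mul measurable_ofReal_jumpSize))
  · refine Filter.Eventually.of_forall fun t => ?_
    have h := one_sub_expNeg_mul_le (v := 1 / ((n : ℝ) + 1)) (by positivity) t
    rwa [max_eq_right, ENNReal.ofReal_one, one_mul] at h
    rw [div_le_one (by positivity)]
    linarith [n.cast_nonneg (α := ℝ)]
  · refine Filter.Eventually.of_forall fun t => ?_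
    have h1 : Filter.Tendsto (fun n : ℕ => ENNReal.ofReal (1 / ((n : ℝ) + 1)) *
        ENNReal.ofReal (t : ℝ)) Filter.atTop (nhds (ENNReal.ofReal 0 * ENNReal.ofReal (t : ℝ))) :=
      ENNReal.Tendsto.mul_const
        (ENNReal.tendsto_ofReal tendsto_one_div_add_atTop_nhds_zero_nat)
        (Or.inr ENNReal.ofReal_ne_top)
    have h2 := ((ENNReal.continuous_sub_left ENNReal.one_ne_top).tendsto _).comp
      ((continuous_expNeg.tendsto _).comp h1)
    simpa [Function.comp_def] using h2

lemma reducedLaplaceExponent_eq {X : Type*} [MeasurableSpace X] (P : Measure X)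
    [IsProbabilityMeasure P] {M : ℝ} (hM : 0 < M) {v : ℝ} (hv : 0 ≤ v) :
    reducedLaplaceExponent M ρ P v = (jumpExponent ρ v).toReal := by
  rw [reducedLaplaceExponent, laplaceExponent, homogeneousLevy, integral_smul_measure,
    ENNReal.toReal_ofReal hM.le, smul_eq_mul, ← mul_assoc, one_div_mul_cancel hM.ne', one_mul]
  have hm : Measurable fun p : JumpSize × X => 1 - Real.exp (-((p.1 : ℝ) * v)) := by fun_prop
  rw [integral_eq_lintegral_of_nonneg_ae _ hm.aestronglyMeasurable, lintegral_prod _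
    hm.ennreal_ofReal.aemeasurable, jumpExponent]
  · congr 1
    refine lintegral_congr fun t => ?_
    dsimp only
    rw [lintegral_const, measure_univ, mul_one, one_sub_expNeg_mul hv (le_of_lt t.2)]
  · refine Filter.Eventually.of_forall fun p => ?_
    have : 0 ≤ (p.1 : ℝ) * v := mul_nonneg (le_of_lt p.1.2) hv
    simpa using this

end

/-! ### Joint Laplace transform and total mass of the completely random measure -/

section

variable {Ω X : Type*} [MeasurableSpace Ω] [MeasurableSpace X]
  {Pr : Measure Ω} [IsProbabilityMeasure Pr] {P : Measure X} [IsProbabilityMeasure P]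
  {M : ℝ} {ρ : Measure JumpSize} {N : Ω → Measure (JumpSize × X)}

lemma measurable_crm (hN : Measurable N) {B : Set X} (hB : MeasurableSet B) :
    Measurable fun ω => crm N ω B := by
  simp_rw [crm, jumpMeasure_apply _ hB, ← lintegral_indicator (MeasurableSet.univ.prod hB)]
  exact (Measure.measurable_lintegral
    (measurable_ofReal_fst.indicator (MeasurableSet.univ.prod hB))).comp hN

/-- The joint Laplace transform of the random masses of a set and of its complement. -/
lemma lintegral_expNeg_crm (hN : IsPoissonRandomMeasure N (homogeneousLevy M ρ P) Pr)
    {B : Set X} (hB : MeasurableSet B) (a b : ℝ) :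
    ∫⁻ ω, expNeg (ENNReal.ofReal a * crm N ω B + ENNReal.ofReal b * crm N ω Bᶜ) ∂Pr =
      expNeg (ENNReal.ofReal M * (jumpExponent ρ a * P B + jumpExponent ρ b * P Bᶜ)) := by
  classical
  set c : X → ℝ≥0∞ := B.piecewise (fun _ => ENNReal.ofReal a) (fun _ => ENNReal.ofReal b) with hc
  have hcm : Measurable c := Measurable.piecewise hB measurable_const measurable_const
  set f : JumpSize × X → ℝ≥0∞ := fun p => c p.2 * ENNReal.ofReal (p.1 : ℝ) with hf
  have hfm : Measurable f :=
    (hcm.comp measurable_snd).mul measurable_ofReal_fst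
  have h1 (ω : Ω) : ∫⁻ p, f p ∂N ω =
      ENNReal.ofReal a * crm N ω B + ENNReal.ofReal b * crm N ω Bᶜ := by
    have hS : MeasurableSet (univ ×ˢ B : Set (JumpSize × X)) := MeasurableSet.univ.prod hB
    have hSc : (univ ×ˢ B : Set (JumpSize × X))ᶜ = univ ×ˢ Bᶜ := by ext; simp
    rw [← lintegral_add_compl f hS, hSc, crm, jumpMeasure_apply _ hB,
      jumpMeasure_apply _ hB.compl,
      ← lintegral_const_mul _ measurable_ofReal_fst,
      ← lintegral_const_mul _ measurable_ofReal_fst]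
    congr 1
    · refine setLIntegral_congr_fun hS fun p hp => ?_
      simp [hf, hc, hp.2]
    · refine setLIntegral_congr_fun (hSc ▸ hS.compl) fun p hp => ?_
      have : p.2 ∉ B := hp.2
      simp [hf, hc, this]
  have h2 : ∫⁻ p, (1 - expNeg (f p)) ∂homogeneousLevy M ρ P =
      ENNReal.ofReal M * (jumpExponent ρ a * P B + jumpExponent ρ b * P Bᶜ) := by
    have hg (v : ℝ) : Measurable fun t : JumpSize =>
        1 - expNeg (ENNReal.ofReal v * ENNReal.ofReal (t : ℝ)) :=
      measurable_const.sub
        (measurable_expNeg.comp (measurable_const.mul measurable_ofReal_jumpSize))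
    have hfm' : Measurable fun p => 1 - expNeg (f p) :=
      measurable_const.sub (measurable_expNeg.comp hfm)
    rw [homogeneousLevy, lintegral_smul_measure, smul_eq_mul, lintegral_prod _ hfm'.aemeasurable,
      jumpExponent, jumpExponent,
      ← lintegral_mul_const _ (hg a), ← lintegral_mul_const _ (hg b),
      ← lintegral_add_left ((hg a).mul_const _)]
    congr 1
    refine lintegral_congr fun t => ?_
    rw [← lintegral_add_compl _ hB]
    congr 1
    · rw [← setLIntegral_const]
      refine setLIntegral_congr_fun hB fun x hx => ?_
      simp [hf, hc, hx]
    · rw [← setLIntegral_const]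
      refine setLIntegral_congr_fun hB.compl fun x hx => ?_
      have : x ∉ B := hx
      simp [hf, hc, this]
  rw [← h2, ← hN.lintegral_expNeg_lintegral hfm]
  simp_rw [h1]

/-- The total mass is almost surely finite, since its Laplace transform tends to `1` at `0`. -/
lemma ae_crm_univ_lt_top (hN : IsPoissonRandomMeasure N (homogeneousLevy M ρ P) Pr)
    (hρ : ∫⁻ t, min (ENNReal.ofReal (t : ℝ)) 1 ∂ρ < ∞) :
    ∀ᵐ ω ∂Pr, crm N ω univ < ∞ := by
  have hT : MeasurableSet {ω | crm N ω univ < ∞} :=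
    measurableSet_lt (measurable_crm hN.measurable MeasurableSet.univ) measurable_const
  -- `exp (-v T)` is at most the indicator of `T < ∞` for every `v > 0`.
  rw [ae_iff_prob_eq_one (measurable_crm hN.measurable MeasurableSet.univ |>.lt measurable_const)]
  refine le_antisymm prob_le_one ?_
  have hbound (n : ℕ) : expNeg (ENNReal.ofReal M * jumpExponent ρ (1 / ((n : ℝ) + 1))) ≤
      Pr {ω | crm N ω univ < ∞} := by
    have h := lintegral_expNeg_crm hN MeasurableSet.univ (1 / ((n : ℝ) + 1)) 0
    simp only [measure_univ, mul_one, compl_univ, measure_empty, mul_zero, add_zero] at h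
    rw [← h, ← lintegral_indicator_one hT]
    refine lintegral_mono fun ω => ?_
    by_cases hω : crm N ω univ < ∞
    · rw [indicator_of_mem (by exact hω)]
      exact expNeg_le_one _
    · rw [not_lt, top_le_iff] at hω
      rw [hω, ENNReal.mul_top, expNeg_top]
      · exact bot_le
      · rw [Ne, ENNReal.ofReal_eq_zero, not_le]
        positivity
  have hlim := (continuous_expNeg.tendsto _).comp (ENNReal.Tendsto.const_mul
    (a := ENNReal.ofReal M) (tendsto_jumpExponent_zero hρ) (Or.inr ENNReal.ofReal_ne_top))
  rw [mul_zero, expNeg_zero] at hlim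
  exact le_of_tendsto' hlim hbound

omit [IsProbabilityMeasure Pr] in
/-- The total mass is almost surely positive, since there are almost surely infinitely many
jumps. -/
lemma ae_crm_univ_pos (hN : IsPoissonRandomMeasure N (homogeneousLevy M ρ P) Pr) (hM : 0 < M)
    (hρ : ρ univ = ∞) : ∀ᵐ ω ∂Pr, 0 < crm N ω univ := by
  have hν : homogeneousLevy M ρ P univ = ∞ := by
    rw [homogeneousLevy, Measure.smul_apply, ← univ_prod_univ, Measure.prod_prod, hρ, measure_univ,
      mul_one, smul_eq_mul, ENNReal.mul_top]
    simpa using hM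
  have hlaw := hN.hasLaw univ MeasurableSet.univ
  rw [hν, poissonLaw, if_pos rfl] at hlaw
  have hae : ∀ᵐ ω ∂Pr, N ω univ = ∞ := by
    refine ae_of_ae_map hlaw.aemeasurable (p := fun y => y = ∞) ?_
    rw [hlaw.map_eq]
    simp [ae_dirac_eq]
  filter_upwards [hae] with ω hω
  rw [pos_iff_ne_zero]
  intro h0
  rw [crm, jumpMeasure_apply _ MeasurableSet.univ, univ_prod_univ, Measure.restrict_univ,
    lintegral_eq_zero_iff measurable_ofReal_fst] at h0
  have hz : N ω univ = 0 := by
    rw [Measure.measure_univ_eq_zero, ← ae_eq_bot, ← Filter.eventually_false_iff_eq_bot]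
    filter_upwards [h0] with p hp
    have hp1 : 0 < (p.1 : ℝ) := p.1.2
    simp only [Pi.zero_apply, ENNReal.ofReal_eq_zero] at hp
    exact absurd hp1 hp.not_gt
  simp [hz] at hω

/-- The joint Laplace transform of the masses of a set and of its complement, with real values. -/
lemma integral_exp_crm (hN : IsPoissonRandomMeasure N (homogeneousLevy M ρ P) Pr) (hM : 0 < M)
    (hρ : ∫⁻ t, min (ENNReal.ofReal (t : ℝ)) 1 ∂ρ < ∞) {B : Set X} (hB : MeasurableSet B)
    {a b : ℝ} (ha : 0 ≤ a) (hb : 0 ≤ b) :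
    ∫ ω, Real.exp (-(a * (crm N ω).real B + b * (crm N ω).real Bᶜ)) ∂Pr =
      Real.exp (-(P.real B * (M * reducedLaplaceExponent M ρ P a) +
        (1 - P.real B) * (M * reducedLaplaceExponent M ρ P b))) := by
  have hXm (B : Set X) (hB : MeasurableSet B) : Measurable fun ω => (crm N ω).real B :=
    (measurable_crm hN.measurable hB).ennreal_toReal
  have hm : Measurable fun ω => Real.exp (-(a * (crm N ω).real B + b * (crm N ω).real Bᶜ)) := by
    have h1 := hXm B hB
    have h2 := hXm Bᶜ hB.compl
    fun_prop
  rw [integral_eq_lintegral_of_nonneg_ae (Filter.Eventually.of_forall fun ω => Real.exp_nonneg _)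
    hm.aestronglyMeasurable]
  have hae : ∫⁻ ω, ENNReal.ofReal
      (Real.exp (-(a * (crm N ω).real B + b * (crm N ω).real Bᶜ))) ∂Pr =
      ∫⁻ ω, expNeg (ENNReal.ofReal a * crm N ω B + ENNReal.ofReal b * crm N ω Bᶜ) ∂Pr := by
    refine lintegral_congr_ae ?_
    filter_upwards [ae_crm_univ_lt_top hN hρ] with ω hω
    have hfin (B : Set X) : crm N ω B ≠ ∞ := ((measure_mono (subset_univ B)).trans_lt hω).ne
    rw [← expNeg_ofReal (add_nonneg (mul_nonneg ha measureReal_nonneg)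
      (mul_nonneg hb measureReal_nonneg)), ENNReal.ofReal_add (mul_nonneg ha measureReal_nonneg)
      (mul_nonneg hb measureReal_nonneg), ENNReal.ofReal_mul ha, ENNReal.ofReal_mul hb,
      ofReal_measureReal (hfin B), ofReal_measureReal (hfin Bᶜ)]
  have hJ (v : ℝ) (hv : 0 ≤ v) :
      jumpExponent ρ v = ENNReal.ofReal (reducedLaplaceExponent M ρ P v) := by
    rw [reducedLaplaceExponent_eq P hM hv, ENNReal.ofReal_toReal (jumpExponent_lt_top hρ hv).ne]
  have hJ0 (v : ℝ) (hv : 0 ≤ v) : 0 ≤ reducedLaplaceExponent M ρ P v := by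
    rw [reducedLaplaceExponent_eq P hM hv]
    exact ENNReal.toReal_nonneg
  have ha' := hJ0 a ha
  have hb' := hJ0 b hb
  rw [hae, lintegral_expNeg_crm hN hB, hJ a ha, hJ b hb, ← ofReal_measureReal (μ := P) (s := B),
    ← ofReal_measureReal (μ := P) (s := Bᶜ), ← ENNReal.ofReal_mul ha', ← ENNReal.ofReal_mul hb',
    ← ENNReal.ofReal_add (by positivity) (by positivity), ← ENNReal.ofReal_mul hM.le,
    expNeg_ofReal (by positivity), ENNReal.toReal_ofReal (Real.exp_nonneg _),
    probReal_compl_eq_one_sub hB]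
  congr 1
  ring

end

/-! ### Exponentially weighted moments from Laplace transforms -/

section LaplaceMoments

variable {Ω : Type*} [MeasurableSpace Ω] {Pr : Measure Ω} {φ : ℝ → ℝ}

lemma integrable_exp_neg_of_nonneg [IsFiniteMeasure Pr] {Z : Ω → ℝ}
    (hZ : Measurable Z) (hZ0 : ∀ ω, 0 ≤ Z ω) :
    Integrable (fun ω => Real.exp (-Z ω)) Pr := by
  refine Integrable.of_bound (C := 1) hZ.neg.exp.aestronglyMeasurable
    (Filter.Eventually.of_forall fun ω => ?_)
  rw [Real.norm_eq_abs, Real.abs_exp]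
  exact Real.exp_le_one_iff.2 (by linarith [hZ0 ω])

lemma mem_interior_integrableExpSet_of_neg [IsFiniteMeasure Pr] {T : Ω → ℝ}
    (hT : Measurable T) (hT0 : ∀ ω, 0 ≤ T ω) {s : ℝ} (hs : s < 0) :
    s ∈ interior (integrableExpSet T Pr) := by
  refine interior_mono (s := Iio 0) (fun u hu => ?_) (by rwa [isOpen_Iio.interior_eq])
  have := integrable_exp_neg_of_nonneg (Pr := Pr) (hT.const_mul (-u))
    (fun ω => mul_nonneg (neg_nonneg.2 (le_of_lt hu)) (hT0 ω))
  simpa [integrableExpSet] using this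

section LaplaceExponent

variable {T : Ω → ℝ} (hT : Measurable T) (hT0 : ∀ ω, 0 ≤ T ω)
  (hφ : ∀ v, 0 < v → ∫ ω, Real.exp (-(v * T ω)) ∂Pr = Real.exp (-φ v))

include hφ in
lemma laplaceExponent_eventuallyEq_cgf {v : ℝ} (hv : 0 < v) :
    φ =ᶠ[nhds v] fun u => -cgf T Pr (-u) := by
  filter_upwards [lt_mem_nhds hv] with u hu
  have : mgf T Pr (-u) = Real.exp (-φ u) := by
    rw [← hφ u hu, mgf]
    simp
  rw [cgf, this, Real.log_exp, neg_neg]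

include hT hT0 hφ in
/-- If `exp (-φ)` is the Laplace transform of a nonnegative random variable, then `φ` is analytic
on the open half line. -/
lemma analyticAt_of_laplace [IsFiniteMeasure Pr] {v : ℝ} (hv : 0 < v) : AnalyticAt ℝ φ v := by
  refine AnalyticAt.congr ?_ (laplaceExponent_eventuallyEq_cgf hφ hv).symm
  have h := analyticAt_cgf (mem_interior_integrableExpSet_of_neg (Pr := Pr) hT hT0
    (neg_lt_zero.2 hv))
  exact (h.fun_comp (f := fun u : ℝ => -u) (by fun_prop)).neg

include hT hT0 hφ in
/-- If `exp (-φ)` is the Laplace transform of a nonnegative random variable, then `-φ''` is the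
variance of that variable under an exponentially tilted law, hence nonnegative. -/
lemma deriv_deriv_nonpos_of_laplace [IsFiniteMeasure Pr] {v : ℝ} (hv : 0 < v) :
    deriv (deriv φ) v ≤ 0 := by
  have h := laplaceExponent_eventuallyEq_cgf hφ hv
  have h1 : deriv (fun u => -cgf T Pr (-u)) = fun u => deriv (cgf T Pr) (-u) := by
    ext u
    rw [deriv.fun_neg, deriv_comp_neg, neg_neg]
  rw [h.deriv.deriv_eq, h1, deriv_comp_neg, neg_nonpos, ← iteratedDeriv_one (f := cgf T Pr),
    ← iteratedDeriv_succ,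
    iteratedDeriv_two_cgf_eq_integral (mem_interior_integrableExpSet_of_neg hT hT0
      (neg_lt_zero.2 hv))]
  refine div_nonneg (integral_nonneg fun ω => ?_) mgf_nonneg
  exact mul_nonneg (sq_nonneg _) (Real.exp_nonneg _)

end LaplaceExponent

section JointLaplace

variable {X Y : Ω → ℝ} (hX : Measurable X) (hY : Measurable Y) (hX0 : ∀ ω, 0 ≤ X ω)
  (hY0 : ∀ ω, 0 ≤ Y ω) {p : ℝ}
  (hφ : ∀ a b, 0 < a → 0 < b →
    ∫ ω, Real.exp (-(a * X ω + b * Y ω)) ∂Pr = Real.exp (-(p * φ a + (1 - p) * φ b)))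

/-- The measure with density `exp (-v Z)` with respect to `Pr`. -/
noncomputable def expWeighted (Pr : Measure Ω) (Z : Ω → ℝ) (v : ℝ) : Measure Ω :=
  Pr.withDensity fun ω => ENNReal.ofReal (Real.exp (-(v * Z ω)))

lemma integral_expWeighted {Z : Ω → ℝ} (hZ : Measurable Z) (v : ℝ) (g : Ω → ℝ) :
    ∫ ω, g ω ∂expWeighted Pr Z v = ∫ ω, g ω * Real.exp (-(v * Z ω)) ∂Pr := by
  rw [expWeighted, integral_withDensity_eq_integral_toReal_smul
    (by fun_prop) (Filter.Eventually.of_forall fun _ => ENNReal.ofReal_lt_top)]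
  refine integral_congr_ae (Filter.Eventually.of_forall fun ω => ?_)
  simp [ENNReal.toReal_ofReal (Real.exp_nonneg _), mul_comm]

include hX hY hX0 hY0 in
lemma zero_mem_interior_integrableExpSet_expWeighted [IsFiniteMeasure Pr] {v : ℝ} (hv : 0 < v) :
    0 ∈ interior (integrableExpSet X (expWeighted Pr (fun ω => X ω + Y ω) v)) := by
  refine interior_mono (s := Iio v) (fun u hu => ?_) (by rwa [isOpen_Iio.interior_eq])
  rw [integrableExpSet, mem_ofPred_eq, expWeighted, integrable_withDensity_iff_integrable_smul'
    (by fun_prop) (Filter.Eventually.of_forall fun _ => ENNReal.ofReal_lt_top)]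
  have := integrable_exp_neg_of_nonneg (Pr := Pr) (Z := fun ω => (v - u) * X ω + v * Y ω)
    (by fun_prop) (fun ω => add_nonneg (mul_nonneg (sub_nonneg.2 (le_of_lt hu)) (hX0 ω))
      (mul_nonneg hv.le (hY0 ω)))
  refine this.congr (Filter.Eventually.of_forall fun ω => ?_)
  simp only [ENNReal.toReal_ofReal (Real.exp_nonneg _), smul_eq_mul, ← Real.exp_add]
  congr 1
  ring

include hX hY hφ in
lemma mgf_expWeighted {v s : ℝ} (hv : 0 < v) (hs : s < v) :
    mgf X (expWeighted Pr (fun ω => X ω + Y ω) v) s =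
      Real.exp (-(p * φ (v - s) + (1 - p) * φ v)) := by
  rw [mgf, integral_expWeighted (Z := fun ω => X ω + Y ω) (by fun_prop),
    ← hφ _ _ (sub_pos.2 hs) hv]
  refine integral_congr_ae (Filter.Eventually.of_forall fun ω => ?_)
  simp only [← Real.exp_add]
  congr 1
  ring

include hX hY hφ in
lemma cgf_expWeighted_eventuallyEq {v : ℝ} (hv : 0 < v) :
    cgf X (expWeighted Pr (fun ω => X ω + Y ω) v) =ᶠ[nhds 0]
      fun s => -(p * φ (v - s) + (1 - p) * φ v) := by
  filter_upwards [gt_mem_nhds hv] with s hs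
  rw [cgf, mgf_expWeighted hX hY hφ hv hs, Real.log_exp]

include hX hY hφ in
lemma deriv_cgf_expWeighted_eventuallyEq {v : ℝ} (hv : 0 < v) :
    deriv (cgf X (expWeighted Pr (fun ω => X ω + Y ω) v)) =ᶠ[nhds 0]
      fun s => p * deriv φ (v - s) := by
  refine (cgf_expWeighted_eventuallyEq hX hY hφ hv).deriv.trans (.of_eq ?_)
  ext s
  rw [deriv.fun_neg, deriv_add_const, deriv_const_mul_field, deriv_comp_const_sub]
  ring

include hX hY hX0 hY0 hφ in
/-- The first exponentially weighted moment, read off from the joint Laplace transform. -/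
lemma integral_mul_exp_of_laplace [IsFiniteMeasure Pr] {v : ℝ} (hv : 0 < v) :
    ∫ ω, X ω * Real.exp (-(v * (X ω + Y ω))) ∂Pr = p * deriv φ v * Real.exp (-φ v) := by
  have h0 := zero_mem_interior_integrableExpSet_expWeighted (Pr := Pr) hX hY hX0 hY0 hv
  have h3 := deriv_cgf h0
  rw [(deriv_cgf_expWeighted_eventuallyEq hX hY hφ hv).eq_of_nhds,
    mgf_expWeighted hX hY hφ hv hv,
    integral_expWeighted (Z := fun ω => X ω + Y ω) (by fun_prop)] at h3
  simp only [zero_mul, Real.exp_zero, mul_one, sub_zero] at h3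
  rw [eq_div_iff (Real.exp_ne_zero _)] at h3
  rw [← h3]
  congr 2
  ring

include hX hY hX0 hY0 hφ in
/-- The second exponentially weighted moment, read off from the joint Laplace transform. -/
lemma integral_sq_mul_exp_of_laplace [IsFiniteMeasure Pr] {v : ℝ} (hv : 0 < v) :
    ∫ ω, X ω ^ 2 * Real.exp (-(v * (X ω + Y ω))) ∂Pr =
      (p ^ 2 * deriv φ v ^ 2 - p * deriv (deriv φ) v) * Real.exp (-φ v) := by
  have h0 := zero_mem_interior_integrableExpSet_expWeighted (Pr := Pr) hX hY hX0 hY0 hv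
  have h3 := iteratedDeriv_two_cgf h0
  have hd := deriv_cgf_expWeighted_eventuallyEq hX hY hφ hv
  rw [iteratedDeriv_succ, iteratedDeriv_one, hd.deriv_eq, hd.eq_of_nhds, deriv_const_mul_field,
    deriv_comp_const_sub, mgf_expWeighted hX hY hφ hv hv,
    integral_expWeighted (Z := fun ω => X ω + Y ω) (by fun_prop)] at h3
  simp only [zero_mul, Real.exp_zero, mul_one, sub_zero] at h3
  rw [eq_sub_iff_add_eq, eq_div_iff (Real.exp_ne_zero _)] at h3
  rw [← h3]
  have : -(p * φ v + (1 - p) * φ v) = -φ v := by ring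
  rw [this]
  ring

end JointLaplace

/-! ### Negative powers as integrals of exponentials -/

lemma integral_Ioi_pow_mul_exp (k : ℕ) {t : ℝ} (ht : 0 < t) :
    ∫ v in Ioi (0 : ℝ), v ^ k * Real.exp (-(v * t)) = k.factorial / t ^ (k + 1) := by
  have h := Real.integral_rpow_mul_exp_neg_mul_Ioi (a := (k : ℝ) + 1) (by positivity) ht
  rw [Real.Gamma_nat_eq_factorial, ← Nat.cast_succ, Real.rpow_natCast, one_div, inv_pow] at h
  rw [div_eq_mul_inv, mul_comm, ← h]
  refine setIntegral_congr_fun measurableSet_Ioi fun v _ => ?_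
  simp [Real.rpow_natCast, mul_comm t v]

lemma integrableOn_Ioi_pow_mul_exp (k : ℕ) {t : ℝ} (ht : 0 < t) :
    IntegrableOn (fun v : ℝ => v ^ k * Real.exp (-(v * t))) (Ioi 0) := by
  -- The integral of a non-integrable function would be `0`.
  by_contra h
  have h1 := integral_Ioi_pow_mul_exp k ht
  rw [integral_undef h] at h1
  have : 0 < (k.factorial : ℝ) / t ^ (k + 1) := by positivity
  exact this.ne h1

section Fubini

variable {Z T : Ω → ℝ} (hZ : Measurable Z) (hT : Measurable T) (hZ0 : ∀ ω, 0 ≤ Z ω)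
  (hT0 : ∀ᵐ ω ∂Pr, 0 < T ω) (k : ℕ) (hint : Integrable (fun ω => Z ω / T ω ^ (k + 1)) Pr)

include hZ hT hZ0 hT0 hint in
lemma integrable_prod_pow_mul_exp [SFinite Pr] :
    Integrable (fun q : Ω × ℝ => Z q.1 * (q.2 ^ k * Real.exp (-(q.2 * T q.1))))
      (Pr.prod (volume.restrict (Ioi 0))) := by
  have hm : Measurable fun q : Ω × ℝ => Z q.1 * (q.2 ^ k * Real.exp (-(q.2 * T q.1))) := by
    fun_prop
  rw [integrable_prod_iff hm.aestronglyMeasurable]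
  constructor
  · filter_upwards [hT0] with ω hω
    exact (integrableOn_Ioi_pow_mul_exp k hω).const_mul _
  · refine (hint.const_mul (k.factorial : ℝ)).congr ?_
    filter_upwards [hT0] with ω hω
    have : ∫ v in Ioi (0 : ℝ), ‖Z ω * (v ^ k * Real.exp (-(v * T ω)))‖ =
        ∫ v in Ioi (0 : ℝ), Z ω * (v ^ k * Real.exp (-(v * T ω))) :=
      setIntegral_congr_fun measurableSet_Ioi fun v hv => by
        have hv0 : 0 < v := hv
        have := hZ0 ω
        exact Real.norm_of_nonneg (by positivity)
    rw [this, integral_const_mul, integral_Ioi_pow_mul_exp k hω]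
    ring

include hZ hT hZ0 hT0 hint in
lemma integrableOn_pow_mul_integral_exp [SFinite Pr] :
    IntegrableOn (fun v : ℝ => v ^ k * ∫ ω, Z ω * Real.exp (-(v * T ω)) ∂Pr) (Ioi 0) := by
  refine (integrable_prod_pow_mul_exp hZ hT hZ0 hT0 k hint).integral_prod_right.congr
    (Filter.Eventually.of_forall fun v => ?_)
  simp only
  rw [← integral_const_mul]
  exact integral_congr_ae (Filter.Eventually.of_forall fun ω => by simp only; ring)

include hZ hT hZ0 hT0 hint in
/-- Expectations of quotients by powers of `T` as integrals of exponentially weighted moments, by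
Fubini and `∫₀^∞ v ^ k exp (-v T) dv = k! / T ^ (k + 1)`. -/
lemma integral_pow_mul_integral_exp [SFinite Pr] :
    ∫ v in Ioi (0 : ℝ), v ^ k * ∫ ω, Z ω * Real.exp (-(v * T ω)) ∂Pr =
      k.factorial * ∫ ω, Z ω / T ω ^ (k + 1) ∂Pr := by
  have h := integral_integral_swap (f := fun ω v => Z ω * (v ^ k * Real.exp (-(v * T ω))))
    (integrable_prod_pow_mul_exp hZ hT hZ0 hT0 k hint)
  rw [← integral_const_mul]
  calc ∫ v in Ioi (0 : ℝ), v ^ k * ∫ ω, Z ω * Real.exp (-(v * T ω)) ∂Pr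
    _ = ∫ v in Ioi (0 : ℝ), ∫ ω, Z ω * (v ^ k * Real.exp (-(v * T ω))) ∂Pr := by
        refine integral_congr_ae (Filter.Eventually.of_forall fun v => ?_)
        simp only
        rw [← integral_const_mul]
        exact integral_congr_ae (Filter.Eventually.of_forall fun ω => by simp only; ring)
    _ = ∫ ω, (∫ v in Ioi (0 : ℝ), Z ω * (v ^ k * Real.exp (-(v * T ω)))) ∂Pr := h.symm
    _ = ∫ ω, k.factorial * (Z ω / T ω ^ (k + 1)) ∂Pr := by
        refine integral_congr_ae ?_
        filter_upwards [hT0] with ω hω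
        rw [integral_const_mul, integral_Ioi_pow_mul_exp k hω]
        ring

end Fubini

end LaplaceMoments

/-! ### Moments of the normalized random measure -/

lemma nrm_real_eq {Ω X : Type*} [MeasurableSpace X] (N : Ω → Measure (JumpSize × X)) (ω : Ω)
    (B : Set X) : (nrm N ω).real B = (crm N ω).real B / (crm N ω).real univ := by
  rw [nrm, measureReal_def, Measure.smul_apply, smul_eq_mul, ENNReal.toReal_mul,
    ENNReal.toReal_inv, measureReal_def, measureReal_def, div_eq_inv_mul]

section

variable {Ω X : Type*} [MeasurableSpace Ω] [MeasurableSpace X]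
  {Pr : Measure Ω} [IsProbabilityMeasure Pr] {P : Measure X} [IsProbabilityMeasure P]
  {M : ℝ} {ρ : Measure JumpSize} {N : Ω → Measure (JumpSize × X)}

lemma measurable_crm_real (hN : Measurable N) {B : Set X} (hB : MeasurableSet B) :
    Measurable fun ω => (crm N ω).real B :=
  (measurable_crm hN hB).ennreal_toReal

lemma ae_crm_real_add_compl (hN : IsPoissonRandomMeasure N (homogeneousLevy M ρ P) Pr)
    (hρ : ∫⁻ t, min (ENNReal.ofReal (t : ℝ)) 1 ∂ρ < ∞) {B : Set X} (hB : MeasurableSet B) :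
    ∀ᵐ ω ∂Pr, (crm N ω).real B + (crm N ω).real Bᶜ = (crm N ω).real univ := by
  filter_upwards [ae_crm_univ_lt_top hN hρ] with ω hω
  have : IsFiniteMeasure (crm N ω) := ⟨hω⟩
  exact measureReal_add_measureReal_compl hB

lemma ae_crm_real_univ_pos (hN : IsPoissonRandomMeasure N (homogeneousLevy M ρ P) Pr) (hM : 0 < M)
    (hρ_infinite : ρ univ = ∞) (hρ : ∫⁻ t, min (ENNReal.ofReal (t : ℝ)) 1 ∂ρ < ∞) :
    ∀ᵐ ω ∂Pr, 0 < (crm N ω).real univ := by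
  filter_upwards [ae_crm_univ_lt_top hN hρ, ae_crm_univ_pos hN hM hρ_infinite] with ω h1 h2
  exact ENNReal.toReal_pos h2.ne' h1.ne

lemma ae_nrm_real_le_one (hN : IsPoissonRandomMeasure N (homogeneousLevy M ρ P) Pr)
    (hρ : ∫⁻ t, min (ENNReal.ofReal (t : ℝ)) 1 ∂ρ < ∞) (B : Set X) :
    ∀ᵐ ω ∂Pr, (nrm N ω).real B ≤ 1 := by
  filter_upwards [ae_crm_univ_lt_top hN hρ] with ω hω
  have : IsFiniteMeasure (crm N ω) := ⟨hω⟩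
  rw [nrm_real_eq]
  exact div_le_one_of_le₀ (measureReal_mono (subset_univ B)) measureReal_nonneg

lemma memLp_nrm_real (hN : IsPoissonRandomMeasure N (homogeneousLevy M ρ P) Pr)
    (hρ : ∫⁻ t, min (ENNReal.ofReal (t : ℝ)) 1 ∂ρ < ∞) {B : Set X} (hB : MeasurableSet B)
    (q : ℝ≥0∞) : MemLp (fun ω => (nrm N ω).real B) q Pr := by
  refine MemLp.of_bound (C := 1) (Measurable.aestronglyMeasurable ?_) ?_
  · simp_rw [nrm_real_eq]
    exact (measurable_crm_real hN.measurable hB).div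
      (measurable_crm_real hN.measurable MeasurableSet.univ)
  · filter_upwards [ae_nrm_real_le_one hN hρ B] with ω hω
    rwa [Real.norm_of_nonneg measureReal_nonneg]

lemma integral_exp_crm_univ (hN : IsPoissonRandomMeasure N (homogeneousLevy M ρ P) Pr)
    (hM : 0 < M) (hρ : ∫⁻ t, min (ENNReal.ofReal (t : ℝ)) 1 ∂ρ < ∞) {v : ℝ} (hv : 0 < v) :
    ∫ ω, Real.exp (-(v * (crm N ω).real univ)) ∂Pr =
      Real.exp (-(M * reducedLaplaceExponent M ρ P v)) := by
  have h := integral_exp_crm hN hM hρ MeasurableSet.univ hv.le hv.le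
  simpa using h

/-- The mean of the normalized mass as an integral over `v`, from `1 / T = ∫₀^∞ exp (-v T) dv`. -/
lemma integral_nrm_real_eq (hN : IsPoissonRandomMeasure N (homogeneousLevy M ρ P) Pr)
    (hM : 0 < M) (hρ_infinite : ρ univ = ∞)
    (hρ : ∫⁻ t, min (ENNReal.ofReal (t : ℝ)) 1 ∂ρ < ∞) {B : Set X} (hB : MeasurableSet B) :
    ∫ ω, (nrm N ω).real B ∂Pr = P.real B *
      ∫ v in Ioi (0 : ℝ), deriv (fun u => M * reducedLaplaceExponent M ρ P u) v *
        Real.exp (-(M * reducedLaplaceExponent M ρ P v)) := by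
  have h := integral_pow_mul_integral_exp (measurable_crm_real hN.measurable hB)
    (measurable_crm_real hN.measurable MeasurableSet.univ) (fun ω => measureReal_nonneg)
    (ae_crm_real_univ_pos hN hM hρ_infinite hρ) 0
    (by simpa [nrm_real_eq] using (memLp_nrm_real hN hρ hB 1).integrable le_rfl)
  simp only [Nat.factorial_zero, Nat.cast_one, one_mul, zero_add, pow_one, pow_zero,
    ← nrm_real_eq] at h
  rw [← h, ← integral_const_mul]
  refine setIntegral_congr_fun measurableSet_Ioi fun v hv => ?_
  rw [← mul_assoc, ← integral_mul_exp_of_laplace (measurable_crm_real hN.measurable hB)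
    (measurable_crm_real hN.measurable hB.compl) (fun ω => measureReal_nonneg)
    (fun ω => measureReal_nonneg) (φ := fun u => M * reducedLaplaceExponent M ρ P u)
    (fun a b ha hb => integral_exp_crm hN hM hρ hB ha.le hb.le) hv]
  refine integral_congr_ae ?_
  filter_upwards [ae_crm_real_add_compl hN hρ hB] with ω hω
  rw [hω]

lemma mul_integral_sq_crm (hN : IsPoissonRandomMeasure N (homogeneousLevy M ρ P) Pr)
    (hM : 0 < M) (hρ : ∫⁻ t, min (ENNReal.ofReal (t : ℝ)) 1 ∂ρ < ∞) {B : Set X}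
    (hB : MeasurableSet B) {v : ℝ} (hv : 0 < v) :
    v ^ 1 * ∫ ω, (crm N ω).real B ^ 2 * Real.exp (-(v * (crm N ω).real univ)) ∂Pr =
      v * (P.real B ^ 2 * deriv (fun u => M * reducedLaplaceExponent M ρ P u) v ^ 2 -
        P.real B * deriv (deriv fun u => M * reducedLaplaceExponent M ρ P u) v) *
        Real.exp (-(M * reducedLaplaceExponent M ρ P v)) := by
  rw [pow_one, mul_assoc, ← integral_sq_mul_exp_of_laplace (measurable_crm_real hN.measurable hB)
    (measurable_crm_real hN.measurable hB.compl) (fun ω => measureReal_nonneg)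
    (fun ω => measureReal_nonneg) (φ := fun u => M * reducedLaplaceExponent M ρ P u)
    (fun a b ha hb => integral_exp_crm hN hM hρ hB ha.le hb.le) hv]
  congr 1
  refine integral_congr_ae ?_
  filter_upwards [ae_crm_real_add_compl hN hρ hB] with ω hω
  rw [hω]

lemma integrable_sq_crm_div (hN : IsPoissonRandomMeasure N (homogeneousLevy M ρ P) Pr)
    (hρ : ∫⁻ t, min (ENNReal.ofReal (t : ℝ)) 1 ∂ρ < ∞) {B : Set X} (hB : MeasurableSet B) :
    Integrable (fun ω => (crm N ω).real B ^ 2 / (crm N ω).real univ ^ (1 + 1)) Pr := by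
  simpa [nrm_real_eq, div_pow] using (memLp_nrm_real hN hρ hB 2).integrable_sq

/-- The second moment of the normalized mass as an integral over `v`, from
`1 / T ^ 2 = ∫₀^∞ v exp (-v T) dv`. -/
lemma integral_sq_nrm_real_eq (hN : IsPoissonRandomMeasure N (homogeneousLevy M ρ P) Pr)
    (hM : 0 < M) (hρ_infinite : ρ univ = ∞)
    (hρ : ∫⁻ t, min (ENNReal.ofReal (t : ℝ)) 1 ∂ρ < ∞) {B : Set X} (hB : MeasurableSet B) :
    ∫ ω, (nrm N ω).real B ^ 2 ∂Pr =
      ∫ v in Ioi (0 : ℝ),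
        v * (P.real B ^ 2 * deriv (fun u => M * reducedLaplaceExponent M ρ P u) v ^ 2 -
          P.real B * deriv (deriv fun u => M * reducedLaplaceExponent M ρ P u) v) *
          Real.exp (-(M * reducedLaplaceExponent M ρ P v)) := by
  have h := integral_pow_mul_integral_exp ((measurable_crm_real hN.measurable hB).pow_const 2)
    (measurable_crm_real hN.measurable MeasurableSet.univ) (fun ω => sq_nonneg _)
    (ae_crm_real_univ_pos hN hM hρ_infinite hρ) 1 (integrable_sq_crm_div hN hρ hB)
  rw [setIntegral_congr_fun measurableSet_Ioi
    fun v hv => mul_integral_sq_crm hN hM hρ hB hv] at h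
  simp only [Nat.factorial_one, Nat.cast_one, one_mul, Nat.reduceAdd] at h
  simp_rw [h, nrm_real_eq, div_pow]

lemma integrableOn_sq_crm_univ (hN : IsPoissonRandomMeasure N (homogeneousLevy M ρ P) Pr)
    (hM : 0 < M) (hρ_infinite : ρ univ = ∞)
    (hρ : ∫⁻ t, min (ENNReal.ofReal (t : ℝ)) 1 ∂ρ < ∞) :
    IntegrableOn (fun v : ℝ => v * (deriv (fun u => M * reducedLaplaceExponent M ρ P u) v ^ 2 -
      deriv (deriv fun u => M * reducedLaplaceExponent M ρ P u) v) *
      Real.exp (-(M * reducedLaplaceExponent M ρ P v))) (Ioi 0) := by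
  have h := integrableOn_pow_mul_integral_exp
    ((measurable_crm_real hN.measurable MeasurableSet.univ).pow_const 2)
    (measurable_crm_real hN.measurable MeasurableSet.univ) (fun ω => sq_nonneg _)
    (ae_crm_real_univ_pos hN hM hρ_infinite hρ) 1
    (integrable_sq_crm_div hN hρ MeasurableSet.univ)
  refine h.congr_fun (fun v hv => ?_) measurableSet_Ioi
  simp only
  rw [mul_integral_sq_crm hN hM hρ MeasurableSet.univ hv]
  simp

end

theorem mainTheorem5 {Ω X : Type*} [MeasurableSpace Ω] [MeasurableSpace X]
    (Pr : Measure Ω) [IsProbabilityMeasure Pr]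
    (P : Measure X) [IsProbabilityMeasure P]
    (M : ℝ) (hM : 0 < M)
    (ρ : Measure JumpSize)
    (hρ_infinite : ρ univ = ∞)
    (hρ_finite : ∫⁻ t, min (ENNReal.ofReal (t : ℝ)) 1 ∂ρ < ∞)
    (N : Ω → Measure (JumpSize × X))
    (hN : IsPoissonRandomMeasure N (homogeneousLevy M ρ P) Pr)
    (B : Set X) (hB : MeasurableSet B) :
    MemLp (fun ω => (nrm N ω).real B) 2 Pr ∧
    ∫ ω, (nrm N ω).real B ∂Pr = P.real B ∧
    (∀ v : ℝ, 0 < v → DifferentiableAt ℝ (reducedLaplaceExponent M ρ P) v ∧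
      DifferentiableAt ℝ (deriv (reducedLaplaceExponent M ρ P)) v) ∧
    IntegrableOn (fun v : ℝ => v * deriv (deriv (reducedLaplaceExponent M ρ P)) v *
      Real.exp (-(M * reducedLaplaceExponent M ρ P v))) (Ioi 0) ∧
    variance (fun ω => (nrm N ω).real B) Pr =
      P.real B * (P.real B - 1) * M *
        ∫ v in Ioi (0 : ℝ), v * deriv (deriv (reducedLaplaceExponent M ρ P)) v *
          Real.exp (-(M * reducedLaplaceExponent M ρ P v)) := by
  set ψ := reducedLaplaceExponent M ρ P with hψ
  have hMψ : deriv (fun u => M * ψ u) = fun v => M * deriv ψ v :=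
    funext fun v => deriv_const_mul_field M
  have hMψ' : deriv (fun v => M * deriv ψ v) = fun v => M * deriv (deriv ψ) v :=
    funext fun v => deriv_const_mul_field M
  have hlap (v : ℝ) (hv : 0 < v) :
      ∫ ω, Real.exp (-(v * (crm N ω).real univ)) ∂Pr = Real.exp (-(M * ψ v)) :=
    integral_exp_crm_univ hN hM hρ_finite hv
  have hTm := measurable_crm_real hN.measurable (MeasurableSet.univ (α := X))
  have hana (v : ℝ) (hv : 0 < v) : AnalyticAt ℝ ψ v := by
    have h := analyticAt_of_laplace (φ := fun u => M * ψ u) hTm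
      (fun ω => measureReal_nonneg) hlap hv
    simpa [inv_mul_cancel_left₀ hM.ne'] using
      (analyticAt_const (v := M⁻¹)).fun_mul h
  have hneg (v : ℝ) (hv : 0 < v) : M * deriv (deriv ψ) v ≤ 0 := by
    have h := deriv_deriv_nonpos_of_laplace (φ := fun u => M * ψ u) hTm
      (fun ω => measureReal_nonneg) hlap hv
    rwa [hMψ, hMψ'] at h
  have hLp := memLp_nrm_real hN hρ_finite hB 2
  -- The case `B = univ`, in which the normalized mass is `1`, evaluates the integrals over `v`.
  have hone : ∀ᵐ ω ∂Pr, (nrm N ω).real univ = 1 := by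
    filter_upwards [ae_crm_real_univ_pos hN hM hρ_infinite hρ_finite] with ω hω
    rw [nrm_real_eq, div_self hω.ne']
  have hmean : ∫ ω, (nrm N ω).real B ∂Pr = P.real B := by
    have h1 := integral_nrm_real_eq hN hM hρ_infinite hρ_finite MeasurableSet.univ
    rw [integral_congr_ae hone, integral_const, probReal_univ, probReal_univ, one_smul,
      one_mul] at h1
    rw [integral_nrm_real_eq hN hM hρ_infinite hρ_finite hB, ← h1, mul_one]
  have hG := integrableOn_sq_crm_univ hN hM hρ_infinite hρ_finite
  have hG1 : ∫ v in Ioi (0 : ℝ), v * ((M * deriv ψ v) ^ 2 - M * deriv (deriv ψ) v) *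
      Real.exp (-(M * ψ v)) = 1 := by
    have h := integral_sq_nrm_real_eq hN hM hρ_infinite hρ_finite MeasurableSet.univ
    have h1 : ∫ ω, (nrm N ω).real univ ^ 2 ∂Pr = 1 := by
      rw [integral_congr_ae (g := fun _ => (1 : ℝ)) (by filter_upwards [hone] with ω hω; simp [hω])]
      simp
    rw [h1, ← hψ, hMψ, hMψ'] at h
    rw [h]
    simp
  rw [← hψ, hMψ, hMψ'] at hG
  have hmeas : AEStronglyMeasurable (fun v : ℝ => v * deriv (deriv ψ) v * Real.exp (-(M * ψ v)))
      (volume.restrict (Ioi 0)) := by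
    have hcont : ContinuousOn ψ (Ioi 0) := fun v hv => (hana v hv).continuousAt.continuousWithinAt
    refine (measurable_id.mul (measurable_deriv _)).aestronglyMeasurable.mul ?_
    exact ContinuousOn.aestronglyMeasurable (by fun_prop) measurableSet_Ioi
  -- Both terms of the integrand for `B = univ` are nonnegative, so it dominates
  -- `-M v ψ'' exp (-M ψ)`.
  have hH : IntegrableOn (fun v : ℝ => v * deriv (deriv ψ) v * Real.exp (-(M * ψ v))) (Ioi 0) := by
    refine Integrable.mono' (hG.const_mul M⁻¹) hmeas ?_
    filter_upwards [ae_restrict_mem measurableSet_Ioi] with v hv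
    have hv0 : 0 < v := hv
    have hd : deriv (deriv ψ) v ≤ 0 := nonpos_of_mul_nonpos_right (hneg v hv) hM
    rw [Real.norm_eq_abs, abs_of_nonpos (mul_nonpos_of_nonpos_of_nonneg
      (mul_nonpos_of_nonneg_of_nonpos hv0.le hd) (Real.exp_nonneg _)), ← sub_nonneg]
    have : M⁻¹ * (v * ((M * deriv ψ v) ^ 2 - M * deriv (deriv ψ) v) * Real.exp (-(M * ψ v))) -
        -(v * deriv (deriv ψ) v * Real.exp (-(M * ψ v))) =
        M * v * deriv ψ v ^ 2 * Real.exp (-(M * ψ v)) := by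
      field_simp
      ring
    rw [this]
    positivity
  refine ⟨hLp, hmean, fun v hv => ⟨(hana v hv).differentiableAt,
    (hana v hv).deriv.differentiableAt⟩,
    hH, ?_⟩
  rw [variance_eq_sub hLp, hmean]
  simp only [Pi.pow_apply]
  rw [integral_sq_nrm_real_eq hN hM hρ_infinite hρ_finite hB, ← hψ, hMψ, hMψ']
  have hsplit : ∀ v : ℝ, v * (P.real B ^ 2 * (M * deriv ψ v) ^ 2 -
      P.real B * (M * deriv (deriv ψ) v)) * Real.exp (-(M * ψ v)) =
      P.real B ^ 2 * (v * ((M * deriv ψ v) ^ 2 - M * deriv (deriv ψ) v) * Real.exp (-(M * ψ v))) +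
      P.real B * (P.real B - 1) * M * (v * deriv (deriv ψ) v * Real.exp (-(M * ψ v))) :=
    fun v => by ring
  simp_rw [hsplit]
  rw [integral_add (hG.const_mul _) (hH.const_mul _), integral_const_mul, integral_const_mul, hG1]
  ring
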